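/- Let $\ell\ge 0$ be an integer and let $P_1,\dots,P_\ell\in\mathbb Z[x]$ be polynomials with integer coefficients such that $P_i(0)=0$ for all $1\le i\le \ell$. Then for every real $\varepsilon>0$ there exists $N_0=N_0(\varepsilon,P_1,\dots,P_\ell)\in\mathbb N$ such that for every integer $N\ge N_0$ with $N\ge 1$ and every set $A\subseteq\{1,\dots,N\}$ there exists an integer $n\ge 1$ such that $$\frac{|A\cap(A+P_i(n))|}{N}>\left(\frac{|A|}{N}\right)^2-\varepsilon\qquad\text{for all }1\le i\le\ell,$$ where $A+m=\{a+m : a\in A\}\subseteq\mathbb Z$ and $|\cdot|$ denotes cardinality. -/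

import Mathlib

open Filter Topology ComplexConjugate MeasureTheory

/-! For A of density δ in [1, N], the normalized autocorrelations of the balanced function 1_A - δ
are the Fourier coefficients of a positive measure of mass at most 1 on the circle. At m they are at
most |A ∩ (A + m)|/N - δ² + 2|m|/N (`exists_finiteMeasure_re_integral_fourier_le`). It thus suffices
to find n, bounded independently of N and A, at which the coefficients at all P_i(n) have real part
above -ε/2. Weak compactness supplies the uniformity: counterexamples with N → ∞ have a limit
measure, and an n good for the limit is good for some of them.

For one measure (`exists_re_integral_fourier_gt`), split off finitely many atoms, an atomic rest of
small mass and an atomless part. By Weyl's theorem and a Wiener-type averaging, the atomless part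
has small coefficients along each nonconstant P_i for all n in a common thick set. Such a set lies
in an idempotent ultrafilter, along which P_i(n)x → 0 for every x, so some n in it also makes the
characters nearly 1 at the chosen atoms. -/

/-! ### Thick sets and recurrence along idempotent ultrafilters -/

/-- The finite-sum set of some sequence lies in a given thick set of naturals. -/
theorem exists_FS_subset_of_thick {T : Set ℕ} (hT : ∀ L, ∃ M, ∀ j ≤ L, M + j ∈ T) :
    ∃ a : Stream' ℕ, Hindman.FS a ⊆ T := by
  choose f hf using hT
  let s : ℕ → ℕ := fun k => Nat.rec 0 (fun _ t => t + f t) k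
  have hs : ∀ k, s (k + 1) = s k + f (s k) := fun k => rfl
  let a : Stream' ℕ := fun k => f (s k)
  -- The slack `j ≤ s k` drives the induction: prepending the term `f (s k)` uses up part of the
  -- slack `s (k + 1) = s k + f (s k)` and leaves `s k`.
  have key : ∀ b : Stream' ℕ, ∀ m, Hindman.FS b m → ∀ k, b = a.drop k →
      ∀ j ≤ s k, m + j ∈ T := by
    intro b m hm
    have hd : ∀ k, (a.drop k).head = f (s k) := fun k => by
      simp [Stream'.head, Stream'.drop, Stream'.get, a]
    have ht : ∀ k, (a.drop k).tail = a.drop (k + 1) := fun k => by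
      simp
    induction hm with
    | head' b =>
      rintro k rfl j hj
      rw [hd]
      exact hf _ _ hj
    | tail' b m _ ih =>
      rintro k rfl j hj
      exact ih (k + 1) (ht k) j (by rw [hs]; omega)
    | cons' b m _ ih =>
      rintro k rfl j hj
      have := ih (k + 1) (ht k) (f (s k) + j) (by rw [hs]; omega)
      rw [hd]
      convert this using 1
      ring
  exact ⟨a, fun m hm => by simpa using key a m hm 0 (by simp) 0 (Nat.zero_le _)⟩

/-- A thick set of naturals belongs to an additively idempotent ultrafilter. -/
theorem exists_idempotent_ultrafilter_of_thick {T : Set ℕ} (hT : ∀ L, ∃ M, ∀ j ≤ L, M + j ∈ T) :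
    ∃ U : Ultrafilter ℕ, T ∈ U ∧
      ∀ p : ℕ → Prop, (∀ᶠ k in U, p k) → ∀ᶠ n in U, ∀ᶠ m in U, p (n + m) := by
  obtain ⟨a, ha⟩ := exists_FS_subset_of_thick hT
  obtain ⟨U, hU, hUa⟩ := Hindman.exists_idempotent_ultrafilter_le_FS a
  refine ⟨U, mem_of_superset hUa ha, fun p hp => ?_⟩
  rw [← Ultrafilter.eventually_add, hU]
  exact hp

/-- Along an idempotent ultrafilter, `P(n) • x` tends to `0` in a compact group if `P(0) = 0`. -/
theorem tendsto_eval_zsmul_idempotent {G : Type*} [AddCommGroup G] [TopologicalSpace G]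
    [IsTopologicalAddGroup G] [CompactSpace G] [T2Space G] {U : Ultrafilter ℕ}
    (hU : ∀ p : ℕ → Prop, (∀ᶠ k in U, p k) → ∀ᶠ n in U, ∀ᶠ m in U, p (n + m)) (x : G)
    (P : Polynomial ℤ) (hP : P.eval 0 = 0) :
    Tendsto (fun n : ℕ => P.eval (n : ℤ) • x) U (𝓝 0) := by
  induction hd : P.natDegree using Nat.strong_induction_on generalizing P with
  | _ d ih =>
  rcases Nat.eq_zero_or_pos d with h0 | hpos
  · rw [Polynomial.eq_C_of_natDegree_eq_zero (hd.trans h0)] at hP ⊢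
    simp only [Polynomial.eval_C] at hP ⊢
    simp [hP]
  have hP0 : P ≠ 0 := by rintro rfl; simp at hd; omega
  -- For fixed n, P(n + m) - P(n) - P(m) has lower degree in m and vanishes at m = 0.
  have hlow : ∀ n : ℕ, Tendsto (fun m : ℕ =>
      P.eval ((n : ℤ) + m) • x - P.eval (n : ℤ) • x - P.eval (m : ℤ) • x) U (𝓝 0) := by
    intro n
    have hlt : (Polynomial.taylor (n : ℤ) P - P).degree < P.degree := by
      have := Polynomial.degree_sub_lt_left (p := Polynomial.taylor (n : ℤ) P) (q := P)
        (Polynomial.degree_taylor _ _) (by simpa [Polynomial.taylor_eq_zero] using hP0)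
        (Polynomial.leadingCoeff_taylor _ _)
      rwa [Polynomial.degree_taylor] at this
    have hlt' : (Polynomial.taylor (n : ℤ) P - P - Polynomial.C (P.eval (n : ℤ))).natDegree < d := by
      rw [Polynomial.natDegree_sub_C]
      by_cases hz : Polynomial.taylor (n : ℤ) P - P = 0
      · simpa [hz] using hpos
      · exact hd ▸ Polynomial.natDegree_lt_natDegree hz hlt
    refine (ih _ hlt' _ (by simp [Polynomial.taylor_eval, hP]) rfl).congr fun m => ?_
    simp only [Polynomial.eval_sub, Polynomial.taylor_eval, Polynomial.eval_C, sub_smul]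
    rw [add_comm (m : ℤ)]
    abel
  obtain ⟨s, -, hs⟩ := isCompact_univ.ultrafilter_le_nhds
    (U.map fun n : ℕ => P.eval (n : ℤ) • x) (by simp)
  replace hs : Tendsto (fun n : ℕ => P.eval (n : ℤ) • x) U (𝓝 s) := hs
  have h2 : ∀ n : ℕ, Tendsto (fun m : ℕ => P.eval ((n : ℤ) + m) • x) U
      (𝓝 (P.eval (n : ℤ) • x + s)) := by
    intro n
    have := ((hlow n).add hs).const_add (P.eval (n : ℤ) • x)
    rw [zero_add] at this
    exact this.congr fun m => by abel
  -- By idempotence the iterated limit of P(n + m)x is again s, while `h2` computes it as s + s;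
  -- closed neighbourhoods carry membership through both limits.
  have hss : s + s = s := by
    by_contra hne
    obtain ⟨C, D, hC, hD, hCD⟩ := t2_separation_nhds hne
    obtain ⟨D', hD', hDc, hDs⟩ := exists_mem_nhds_isClosed_subset hD
    have h3 := hU _ (hs.eventually_mem hD')
    have h4 : ∀ᶠ n : ℕ in U, P.eval (n : ℤ) • x + s ∈ D' := by
      filter_upwards [h3] with n hn
      exact hDc.mem_of_tendsto (h2 n) (by simpa using hn)
    exact Set.disjoint_left.1 hCD (mem_of_mem_nhds hC)
      (hDs (hDc.mem_of_tendsto (hs.add_const s) h4))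
  rwa [add_eq_left.1 hss] at hs

/-- A nonnegative sequence whose averages tend to zero is small on a thick set. -/
theorem thick_of_tendsto_mean {c : ℕ → ℝ} (hc : ∀ n, 0 ≤ c n)
    (h : Tendsto (fun N : ℕ => (∑ n ∈ Finset.range N, c n) / N) atTop (𝓝 0)) {η : ℝ} (hη : 0 < η) :
    ∀ L : ℕ, ∃ M, ∀ j ≤ L, M + j ∈ {n : ℕ | c n < η} := by
  intro L
  by_contra! hcon
  simp only [Set.mem_ofPred_eq, not_lt] at hcon
  -- Every block of L + 1 consecutive indices contains a term at least η.
  have hsum : ∀ k : ℕ, k * η ≤ ∑ n ∈ Finset.range (k * (L + 1)), c n := by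
    intro k
    induction k with
    | zero => simp
    | succ k ih =>
      rw [add_mul k 1, one_mul, Finset.sum_range_add]
      obtain ⟨j, hj, hcj⟩ := hcon (k * (L + 1))
      have := Finset.single_le_sum (f := fun i => c (k * (L + 1) + i)) (s := Finset.range (L + 1))
        (fun i _ => hc _) (Finset.mem_range.2 (Nat.lt_succ_of_le hj))
      push_cast
      linarith
  have ht : Tendsto (fun k : ℕ => (k + 1) * (L + 1)) atTop atTop :=
    tendsto_atTop_mono (fun k => show k ≤ _ by nlinarith [Nat.zero_le (k * L)]) tendsto_id
  have hle := ge_of_tendsto' (b := η / (L + 1)) (h.comp ht) (fun k => by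
    have := hsum (k + 1)
    simp only [Function.comp]
    push_cast at this ⊢
    rw [div_le_div_iff₀ (by positivity) (by positivity)]
    nlinarith [show (0 : ℝ) ≤ L by positivity])
  have : 0 < η / (L + 1) := by positivity
  linarith

/-! ### Van der Corput's theorem and Weyl sums -/

/-- Average of the first `N` terms of a sequence. -/
noncomputable def cesaroMean (u : ℕ → ℂ) (N : ℕ) : ℂ := (∑ n ∈ Finset.range N, u n) / N

theorem norm_cesaroMean_shift_sub_le {u : ℕ → ℂ} (hu : ∀ n, ‖u n‖ ≤ 1) (h N : ℕ) :
    ‖cesaroMean (fun n => u (n + h)) N - cesaroMean u N‖ ≤ 2 * h / N := by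
  have h1 : ∑ n ∈ Finset.range N, u (n + h) + ∑ n ∈ Finset.range h, u n =
      ∑ n ∈ Finset.range N, u n + ∑ n ∈ Finset.range h, u (N + n) := by
    rw [← Finset.sum_range_add, add_comm N h, Finset.sum_range_add, add_comm]
    simp only [add_comm h]
  have h2 : ∑ n ∈ Finset.range N, u (n + h) - ∑ n ∈ Finset.range N, u n =
      ∑ n ∈ Finset.range h, (u (N + n) - u n) := by
    rw [Finset.sum_sub_distrib]; linear_combination h1
  rw [cesaroMean, cesaroMean, ← sub_div, h2, norm_div, Complex.norm_natCast]
  gcongr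
  refine (norm_sum_le_of_le _ (f := fun n => u (N + n) - u n) (n := fun _ => (2 : ℝ))
    fun n _ => (norm_sub_le _ _).trans ?_).trans ?_
  · linarith [hu n, hu (N + n)]
  · simp [mul_comm]

theorem tendsto_cesaroMean_shift_sub {u : ℕ → ℂ} (hu : ∀ n, ‖u n‖ ≤ 1) (h : ℕ) :
    Tendsto (fun N => cesaroMean (fun n => u (n + h)) N - cesaroMean u N) atTop (𝓝 0) :=
  squeeze_zero_norm (norm_cesaroMean_shift_sub_le hu h) (tendsto_const_div_atTop_nhds_zero_nat _)

theorem norm_cesaroMean_sq_le (w : ℕ → ℂ) (N : ℕ) :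
    ‖cesaroMean w N‖ ^ 2 ≤ (∑ n ∈ Finset.range N, ‖w n‖ ^ 2) / N := by
  rcases Nat.eq_zero_or_pos N with rfl | hN
  · simp [cesaroMean]
  have hN' : (0 : ℝ) < N := by exact_mod_cast hN
  rw [cesaroMean, norm_div, Complex.norm_natCast, div_pow, div_le_div_iff₀ (by positivity) hN']
  have h1 : ‖∑ n ∈ Finset.range N, w n‖ ^ 2 ≤ (∑ n ∈ Finset.range N, ‖w n‖) ^ 2 := by
    gcongr; exact norm_sum_le _ _
  have h2 := sq_sum_le_card_mul_sum_sq (s := Finset.range N) (f := fun n => ‖w n‖)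
  rw [Finset.card_range] at h2
  nlinarith

/-- **van der Corput's difference theorem** for bounded complex sequences. -/
theorem tendsto_cesaroMean_of_correlations {u : ℕ → ℂ} (hu : ∀ n, ‖u n‖ ≤ 1)
    (h : ∀ k : ℕ, 0 < k → Tendsto (cesaroMean fun n => u (n + k) * conj (u n)) atTop (𝓝 0)) :
    Tendsto (cesaroMean u) atTop (𝓝 0) := by
  have hcorr : ∀ i j : ℕ, i ≠ j →
      Tendsto (cesaroMean fun n => u (n + i) * conj (u (n + j))) atTop (𝓝 0) := by
    have hlt : ∀ i j : ℕ, j < i →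
        Tendsto (cesaroMean fun n => u (n + i) * conj (u (n + j))) atTop (𝓝 0) := by
      intro i j hij
      have h1 := tendsto_cesaroMean_shift_sub (u := fun n => u (n + (i - j)) * conj (u n))
        (fun n => by
          rw [norm_mul, RCLike.norm_conj]
          exact mul_le_one₀ (hu _) (norm_nonneg _) (hu _)) j
      have h2 := h1.add (h (i - j) (by omega))
      rw [add_zero] at h2
      refine h2.congr fun N => ?_
      rw [sub_add_cancel]
      congr 1
      funext n
      rw [show n + j + (i - j) = n + i by omega]
    intro i j hij
    rcases lt_or_gt_of_ne hij with hl | hl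
    · have h1 := (Complex.continuous_conj.tendsto 0).comp (hlt j i hl)
      rw [map_zero] at h1
      refine h1.congr fun N => ?_
      simp [cesaroMean, map_div₀, map_sum, mul_comm]
    · exact hlt i j hl
  -- Averaging over H shifts changes the mean by d → 0. In the mean square of the shifted average
  -- `w`, only the H diagonal terms out of H² survive, giving 1/H; splitting off d doubles this to
  -- 2/H, and 4/H leaves room.
  have hbound : ∀ H : ℕ, 0 < H → ∀ᶠ N in atTop, ‖cesaroMean u N‖ ^ 2 ≤ 4 / H := by
    intro H hH
    have hH' : (0 : ℝ) < H := by exact_mod_cast hH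
    let d : ℕ → ℂ := fun N =>
      (∑ i ∈ Finset.range H, (cesaroMean (fun n => u (n + i)) N - cesaroMean u N)) / H
    let w : ℕ → ℂ := fun n => (∑ i ∈ Finset.range H, u (n + i)) / H
    let g : ℕ → ℝ := fun N => (∑ i ∈ Finset.range H, ∑ j ∈ Finset.range H,
      if i = j then (1 : ℝ) else ‖cesaroMean (fun n => u (n + i) * conj (u (n + j))) N‖) / H ^ 2
    have hd : Tendsto d atTop (𝓝 0) := by
      have := (tendsto_finsetSum (Finset.range H) fun i _ =>
        tendsto_cesaroMean_shift_sub hu i).div_const (H : ℂ)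
      simpa only [Finset.sum_const_zero, zero_div] using this
    have hg : Tendsto g atTop (𝓝 (1 / H)) := by
      have h1 : Tendsto g atTop (𝓝 ((∑ i ∈ Finset.range H, ∑ j ∈ Finset.range H,
          if i = j then (1 : ℝ) else 0) / H ^ 2)) := by
        refine (tendsto_finsetSum _ fun i _ => tendsto_finsetSum _ fun j _ => ?_).div_const _
        split_ifs with hij
        · exact tendsto_const_nhds
        · exact tendsto_zero_iff_norm_tendsto_zero.1 (hcorr i j hij)
      convert h1 using 2
      have h2 : ∀ i ∈ Finset.range H,
          (∑ j ∈ Finset.range H, if i = j then (1 : ℝ) else 0) = 1 := fun i hi => by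
        rw [Finset.sum_ite_eq, if_pos hi]
      rw [Finset.sum_congr rfl h2]
      simp
      field_simp
    have hw : ∀ N, cesaroMean u N = cesaroMean w N - d N := by
      intro N
      have h1 : cesaroMean w N = (∑ i ∈ Finset.range H, cesaroMean (fun n => u (n + i)) N) / H := by
        simp only [cesaroMean, w, ← Finset.sum_div]
        rw [Finset.sum_comm, div_right_comm]
      have h2 : (H : ℂ) ≠ 0 := by exact_mod_cast hH.ne'
      simp only [h1, d, Finset.sum_sub_distrib, Finset.sum_const, Finset.card_range, nsmul_eq_mul]
      field_simp
      ring
    have hwg : ∀ N, ‖cesaroMean w N‖ ^ 2 ≤ g N := by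
      intro N
      refine (norm_cesaroMean_sq_le w N).trans ?_
      have h1 : (((∑ n ∈ Finset.range N, ‖w n‖ ^ 2) / N : ℝ) : ℂ) =
          (∑ i ∈ Finset.range H, ∑ j ∈ Finset.range H,
            cesaroMean (fun n => u (n + i) * conj (u (n + j))) N) / H ^ 2 := by
        have h2 : ∀ n, ((‖w n‖ : ℂ)) ^ 2 = (∑ i ∈ Finset.range H, ∑ j ∈ Finset.range H,
            u (n + i) * conj (u (n + j))) / H ^ 2 := by
          intro n
          rw [← Complex.mul_conj', ← Finset.sum_mul_sum, ← map_sum]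
          simp only [w, map_div₀, Complex.conj_natCast]
          rw [div_mul_div_comm, sq]
        push_cast
        simp only [h2, cesaroMean, ← Finset.sum_div]
        rw [div_right_comm, Finset.sum_comm]
        simp_rw [Finset.sum_comm (s := Finset.range N)]
      have h3 : (∑ n ∈ Finset.range N, ‖w n‖ ^ 2) / N =
          ‖(((∑ n ∈ Finset.range N, ‖w n‖ ^ 2) / N : ℝ) : ℂ)‖ := by
        rw [Complex.norm_real, Real.norm_of_nonneg (by positivity)]
      rw [h3, h1, norm_div, norm_pow, Complex.norm_natCast]
      refine div_le_div_of_nonneg_right ?_ (by positivity)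
      refine norm_sum_le_of_le _ fun i _ => norm_sum_le_of_le _ fun j _ => ?_
      split_ifs
      · rw [cesaroMean, norm_div, Complex.norm_natCast]
        refine div_le_one_of_le₀ ?_ (by positivity)
        refine (norm_sum_le_of_le _ (n := fun _ => (1 : ℝ)) fun n _ => ?_).trans (by simp)
        rw [norm_mul, RCLike.norm_conj]
        exact mul_le_one₀ (hu _) (norm_nonneg _) (hu _)
      · exact le_rfl
    have hlim : Tendsto (fun N : ℕ => 2 * ‖d N‖ ^ 2 + 2 * g N) atTop (𝓝 (2 / (H : ℝ))) := by
      have := ((hd.norm.pow 2).const_mul 2).add (hg.const_mul 2)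
      simpa [div_eq_mul_inv] using this
    filter_upwards [hlim.eventually_lt_const
      (show 2 / (H : ℝ) < 4 / H by gcongr; norm_num)] with N hN
    have h1 : ‖cesaroMean u N‖ ≤ ‖cesaroMean w N‖ + ‖d N‖ := by
      rw [hw N]; exact norm_sub_le _ _
    nlinarith [hwg N, sq_nonneg (‖cesaroMean w N‖ - ‖d N‖), norm_nonneg (cesaroMean u N)]
  rw [tendsto_zero_iff_norm_tendsto_zero, Metric.tendsto_atTop']
  intro ε hε
  obtain ⟨H, hH⟩ := exists_nat_gt (4 / ε ^ 2)
  have hHpos : (0 : ℝ) < H := lt_of_le_of_lt (by positivity) hH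
  obtain ⟨N₀, hN₀⟩ := eventually_atTop.1 (hbound H (by exact_mod_cast hHpos))
  refine ⟨N₀, fun N hN => ?_⟩
  have h1 := hN₀ N hN.le
  have h2 : 4 / (H : ℝ) < ε ^ 2 := by
    rw [div_lt_iff₀ (by positivity)] at hH ⊢
    linarith
  rw [Real.dist_eq, sub_zero, abs_norm]
  exact lt_of_pow_lt_pow_left₀ 2 hε.le (h1.trans_lt h2)

theorem tendsto_cesaroMean_pow {z : ℂ} (hz : ‖z‖ ≤ 1) (hz1 : z ≠ 1) :
    Tendsto (cesaroMean fun n => z ^ n) atTop (𝓝 0) := by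
  refine squeeze_zero_norm (a := fun N : ℕ => 2 / ‖z - 1‖ / N) (fun N => ?_)
    (tendsto_const_div_atTop_nhds_zero_nat _)
  rw [cesaroMean, geom_sum_eq hz1, norm_div, norm_div, Complex.norm_natCast]
  gcongr
  refine (norm_sub_le _ _).trans ?_
  rw [norm_pow, norm_one]
  linarith [pow_le_one₀ (n := N) (norm_nonneg z) hz]

/-- A nonconstant integer polynomial of degree at least two has nonconstant differences. -/
theorem Polynomial.natDegree_taylor_sub_pos {P : Polynomial ℤ} (hP : 2 ≤ P.natDegree) {k : ℕ}
    (hk : 0 < k) : 0 < (Polynomial.taylor (k : ℤ) P - P).natDegree := by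
  by_contra hcon
  have hC := Polynomial.eq_C_of_natDegree_eq_zero (Nat.eq_zero_of_not_pos hcon)
  set c := (Polynomial.taylor (k : ℤ) P - P).coeff 0
  have hstep : ∀ y : ℤ, P.eval (y + k) = P.eval y + c := by
    intro y
    have := congrArg (Polynomial.eval y) hC
    simp only [Polynomial.eval_sub, Polynomial.taylor_eval, Polynomial.eval_C] at this
    linarith
  have hlin : ∀ m : ℕ, P.eval ((m : ℤ) * k) = P.eval 0 + m * c := by
    intro m
    induction m with
    | zero => simp
    | succ m ih => push_cast; rw [add_mul, one_mul, hstep, ih]; ring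
  -- A constant k-step difference makes P affine on the multiples of k, which are infinitely many.
  have heq : Polynomial.C (k : ℤ) * P =
      Polynomial.C (k * P.eval 0) + Polynomial.C c * Polynomial.X := by
    refine Polynomial.eq_of_infinite_eval_eq _ _ (Set.Infinite.mono (s := Set.range
      fun m : ℕ => (m : ℤ) * k) ?_ (Set.infinite_range_of_injective fun a b hab => ?_))
    · rintro _ ⟨m, rfl⟩
      simp [hlin]
      ring
    · have hk' : (k : ℤ) ≠ 0 := by exact_mod_cast hk.ne'
      exact_mod_cast mul_right_cancel₀ hk' hab
  have h1 := congrArg Polynomial.natDegree heq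
  rw [Polynomial.natDegree_C_mul (by exact_mod_cast hk.ne')] at h1
  have h2 : (Polynomial.C (k * P.eval 0) + Polynomial.C c * Polynomial.X).natDegree ≤ 1 := by
    compute_degree
  omega

/-- **Weyl's theorem**: exponential averages along a nonconstant integer polynomial vanish at
every non-torsion point of the circle. -/
theorem tendsto_cesaroMean_fourier_eval {x : UnitAddCircle} (hx : ¬ IsOfFinAddOrder x)
    {P : Polynomial ℤ} (hP : 0 < P.natDegree) :
    Tendsto (cesaroMean fun n => fourier (P.eval (n : ℤ)) x) atTop (𝓝 0) := by
  have hne : ∀ m : ℤ, m ≠ 0 → fourier m x ≠ 1 := by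
    intro m hm h1
    rw [fourier_apply, ← fourier_zero' (T := 1)] at h1
    have h2 := AddCircle.injective_toCircle one_ne_zero (Subtype.ext h1)
    exact hx ((isOfFinAddOrder_iff_zsmul_eq_zero).2 ⟨m, hm, h2⟩)
  induction hd : P.natDegree using Nat.strong_induction_on generalizing P with
  | _ d ih =>
  rcases Nat.lt_or_ge d 2 with h2 | h2
  · have hP1 : P.natDegree = 1 := by omega
    obtain ⟨a, ha, b, rfl⟩ := Polynomial.natDegree_eq_one.1 hP1
    have h := (tendsto_cesaroMean_pow (z := fourier a x) (Circle.norm_coe _).le (hne a ha)).const_mul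
      (fourier b x : ℂ)
    rw [mul_zero] at h
    refine h.congr fun N => ?_
    rw [cesaroMean, cesaroMean, mul_div_assoc', Finset.mul_sum]
    congr 2
    funext n
    have hpow : ∀ n : ℕ, fourier (a * n) x = (fourier a x : ℂ) ^ n := by
      intro n
      induction n with
      | zero => simp
      | succ n ihn =>
        push_cast
        rw [mul_add, mul_one, fourier_add, ihn, pow_succ]
    simp only [Polynomial.eval_add, Polynomial.eval_mul, Polynomial.eval_C, Polynomial.eval_X]
    rw [fourier_add, hpow, mul_comm]
  -- The correlation at shift k is the exponential mean along P(n + k) - P(n), of lower but still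
  -- positive degree.
  · refine tendsto_cesaroMean_of_correlations (fun n => (Circle.norm_coe _).le) fun k hk => ?_
    have hP0 : P ≠ 0 := by rintro rfl; simp at hP
    have hpos := Polynomial.natDegree_taylor_sub_pos (hd ▸ h2) hk
    have hlt : (Polynomial.taylor (k : ℤ) P - P).degree < P.degree := by
      have := Polynomial.degree_sub_lt_left (p := Polynomial.taylor (k : ℤ) P) (q := P)
        (Polynomial.degree_taylor _ _) (by simpa [Polynomial.taylor_eq_zero] using hP0)
        (Polynomial.leadingCoeff_taylor _ _)
      rwa [Polynomial.degree_taylor] at this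
    have hlt' := hd ▸ Polynomial.natDegree_lt_natDegree
      (fun h0 => by rw [h0] at hpos; simp at hpos) hlt
    convert ih _ hlt' hpos rfl using 3 with n
    rw [← fourier_neg, ← fourier_add]
    simp [Polynomial.taylor_eval, sub_eq_add_neg]

/-! ### Fourier coefficients of atomless measures -/

theorem integrable_fourier_comp_sub (ν : Measure UnitAddCircle) [IsFiniteMeasure ν] (m : ℤ) :
    Integrable (fun p : UnitAddCircle × UnitAddCircle => (fourier m (p.1 - p.2) : ℂ))
      (ν.prod ν) :=
  Integrable.of_bound (C := 1) (by fun_prop) (ae_of_all _ fun _ => (Circle.norm_coe _).le)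

/-- Makes the squared coefficient linear in the character, so that averages over n pass inside the
integral and Weyl's theorem applies at x - y. -/
theorem integral_fourier_mul_conj (ν : Measure UnitAddCircle) [IsFiniteMeasure ν] (m : ℤ) :
    ((‖∫ x, (fourier m x : ℂ) ∂ν‖ ^ 2 : ℝ) : ℂ) =
      ∫ p : UnitAddCircle × UnitAddCircle, (fourier m (p.1 - p.2) : ℂ) ∂(ν.prod ν) := by
  push_cast
  rw [← Complex.mul_conj', ← integral_conj, ← integral_prod_mul]
  congr 1
  funext p
  rw [← fourier_neg, fourier_apply, fourier_apply, fourier_apply, ← Circle.coe_mul,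
    ← AddCircle.toCircle_add]
  congr 2
  rw [smul_sub, neg_smul, sub_eq_add_neg]

/-- The circle has countably many torsion points, so each slice of the exceptional set is countable,
hence null. -/
theorem ae_prod_not_isOfFinAddOrder_sub (ν : Measure UnitAddCircle) [IsFiniteMeasure ν]
    [NullSingletonClass ν] :
    ∀ᵐ p : UnitAddCircle × UnitAddCircle ∂(ν.prod ν), ¬ IsOfFinAddOrder (p.1 - p.2) := by
  have hcount : {x : UnitAddCircle | IsOfFinAddOrder x}.Countable := by
    have : {x : UnitAddCircle | IsOfFinAddOrder x} ⊆
        ⋃ n : ℕ, {x : UnitAddCircle | 0 < n ∧ n • x = 0} := by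
      intro x hx
      obtain ⟨n, hn, hnx⟩ := isOfFinAddOrder_iff_nsmul_eq_zero.1 hx
      exact Set.mem_iUnion.2 ⟨n, hn, hnx⟩
    refine (Set.countable_iUnion fun n => Set.Finite.countable ?_).mono this
    rcases Nat.eq_zero_or_pos n with rfl | hn
    · simp
    · exact (AddCircle.finite_torsion 1 hn).subset fun x hx => hx.2
  have hmeas : MeasurableSet {p : UnitAddCircle × UnitAddCircle | IsOfFinAddOrder (p.1 - p.2)} :=
    (measurable_fst.sub measurable_snd) hcount.measurableSet
  have hzero : (ν.prod ν) {p : UnitAddCircle × UnitAddCircle | IsOfFinAddOrder (p.1 - p.2)} = 0 := by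
    rw [Measure.measure_prod_null hmeas]
    refine ae_of_all _ fun x => ?_
    refine (Set.Countable.measure_zero ?_ ν :)
    exact hcount.preimage (f := fun y => x - y) sub_right_injective
  rw [ae_iff]
  simpa using hzero

/-- Fourier coefficients of an atomless measure along a nonconstant integer polynomial tend to
zero in quadratic mean. -/
theorem tendsto_mean_normSq_integral_fourier (ν : Measure UnitAddCircle) [IsFiniteMeasure ν]
    [NullSingletonClass ν] {P : Polynomial ℤ} (hP : 0 < P.natDegree) :
    Tendsto (fun N : ℕ => (∑ n ∈ Finset.range N,
      ‖∫ x, (fourier (P.eval (n : ℤ)) x : ℂ) ∂ν‖ ^ 2) / N) atTop (𝓝 0) := by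
  have hdct : Tendsto (fun N : ℕ => ∫ p : UnitAddCircle × UnitAddCircle,
      cesaroMean (fun n => (fourier (P.eval (n : ℤ)) (p.1 - p.2) : ℂ)) N ∂(ν.prod ν)) atTop
      (𝓝 (∫ _ : UnitAddCircle × UnitAddCircle, (0 : ℂ) ∂(ν.prod ν))) := by
    refine tendsto_integral_of_dominated_convergence (fun _ => (1 : ℝ)) (fun N => ?_)
      (integrable_const _) (fun N => ae_of_all _ fun p => ?_) ?_
    · unfold cesaroMean
      fun_prop
    · rw [cesaroMean, norm_div, Complex.norm_natCast]
      refine div_le_one_of_le₀ ?_ (by positivity)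
      exact (norm_sum_le_of_le _ (n := fun _ => (1 : ℝ)) fun n _ => (Circle.norm_coe _).le).trans
        (by simp)
    · filter_upwards [ae_prod_not_isOfFinAddOrder_sub ν] with p hp
      exact tendsto_cesaroMean_fourier_eval hp hP
  rw [integral_zero] at hdct
  have h := hdct.norm
  rw [norm_zero] at h
  refine h.congr fun N => ?_
  have h1 : ∫ p : UnitAddCircle × UnitAddCircle,
      cesaroMean (fun n => (fourier (P.eval (n : ℤ)) (p.1 - p.2) : ℂ)) N ∂(ν.prod ν) =
      (((∑ n ∈ Finset.range N, ‖∫ x, (fourier (P.eval (n : ℤ)) x : ℂ) ∂ν‖ ^ 2) / N : ℝ) : ℂ) := by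
    simp only [cesaroMean]
    rw [integral_div, integral_finsetSum _ fun n _ => integrable_fourier_comp_sub ν _]
    simp only [← integral_fourier_mul_conj]
    push_cast
    rfl
  rw [h1, Complex.norm_real, Real.norm_of_nonneg (by positivity)]

/-! ### Recurrence for a single measure -/

/-- Up to an arbitrarily small part, a finite measure on the circle is the sum of a measure
on finitely many points and an atomless one. -/
theorem exists_finite_small_noAtoms (μ : Measure UnitAddCircle) [IsFiniteMeasure μ] {ε : ℝ}
    (hε : 0 < ε) : ∃ F C : Set UnitAddCircle, F.Finite ∧ MeasurableSet C ∧ F ⊆ C ∧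
      μ.real (C \ F) < ε ∧ NullSingletonClass (μ.restrict Cᶜ) := by
  let F : ℕ → Set UnitAddCircle := fun k => {x | ((k : ENNReal) + 1)⁻¹ ≤ μ {x}}
  have hF : ∀ k, (F k).Finite := fun k =>
    Measure.finite_const_le_meas_of_disjoint_iUnion μ (As := fun x : UnitAddCircle => {x})
      (by simp) (fun x => measurableSet_singleton x)
      (fun x y hxy => by simpa [Function.onFun] using hxy) (measure_ne_top _ _)
  have hmono : Monotone F := by
    intro j k hjk x hx
    refine le_trans ?_ (show ((j : ENNReal) + 1)⁻¹ ≤ μ {x} from hx)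
    gcongr
  let C : Set UnitAddCircle := ⋃ k, F k
  have hC : MeasurableSet C := MeasurableSet.iUnion fun k => (hF k).measurableSet
  have hlim : Tendsto (fun k => μ (C \ F k)) atTop (𝓝 0) := by
    have h := tendsto_measure_iInter_atTop (μ := μ) (s := fun k => C \ F k)
      (fun k => (hC.diff (hF k).measurableSet).nullMeasurableSet)
      (fun j k hjk => Set.sdiff_subset_sdiff_right (hmono hjk)) ⟨0, measure_ne_top _ _⟩
    have he : ⋂ k, C \ F k = ∅ := by
      rw [← Set.sdiff_iUnion]
      exact Set.sdiff_self
    rwa [he, measure_empty] at h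
  obtain ⟨k, hk⟩ := (hlim.eventually_lt_const (ENNReal.ofReal_pos.2 hε)).exists
  refine ⟨F k, C, hF k, hC, Set.subset_iUnion F k, ?_, ⟨fun x => ?_⟩⟩
  · exact ENNReal.toReal_lt_of_lt_ofReal hk
  · rw [Measure.restrict_apply (measurableSet_singleton x)]
    by_cases hx : x ∈ C
    · rw [Set.singleton_inter_eq_empty.2 (by simpa using hx), measure_empty]
    · refine measure_mono_null Set.inter_subset_left ?_
      by_contra hne
      obtain ⟨n, hn⟩ := ENNReal.exists_inv_nat_lt hne
      exact hx (Set.mem_iUnion.2 ⟨n, le_trans (ENNReal.inv_le_inv.2 (by simp)) hn.le⟩)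

/-- Simultaneous polynomial recurrence for Fourier coefficients of a finite positive measure. -/
theorem exists_re_integral_fourier_gt {ι : Type*} [Finite ι] (μ : Measure UnitAddCircle)
    [IsFiniteMeasure μ] (P : ι → Polynomial ℤ) (hP : ∀ i, (P i).eval 0 = 0) {ε : ℝ} (hε : 0 < ε) :
    ∃ n : ℕ, 0 < n ∧ ∀ i, -ε < (∫ x, (fourier ((P i).eval (n : ℤ)) x : ℂ) ∂μ).re := by
  have := Fintype.ofFinite ι
  obtain ⟨F, C, hF, hC, hFC, hsmall, hno⟩ := exists_finite_small_noAtoms μ (half_pos hε)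
  let s : Finset ι := Finset.univ.filter fun i => 0 < (P i).natDegree
  let a : ι → ℕ → ℝ := fun i n =>
    ‖∫ x in Cᶜ, (fourier ((P i).eval (n : ℤ)) x : ℂ) ∂μ‖ ^ 2
  have hlim : Tendsto (fun N : ℕ => (∑ n ∈ Finset.range N, ∑ i ∈ s, a i n) / N) atTop (𝓝 0) := by
    have h := tendsto_finsetSum s fun i hi =>
      tendsto_mean_normSq_integral_fourier (μ.restrict Cᶜ) (P := P i) (Finset.mem_filter.1 hi).2
    rw [Finset.sum_const_zero] at h
    refine h.congr fun N => ?_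
    rw [← Finset.sum_div, Finset.sum_comm]
  have hthick := thick_of_tendsto_mean
    (fun n => Finset.sum_nonneg fun i _ => sq_nonneg _) hlim (show 0 < (ε / 2) ^ 2 by positivity)
  -- Shifting the interval by one excludes n = 0, where recurrence would be trivial.
  have hthick' : ∀ L : ℕ, ∃ M, ∀ j ≤ L,
      M + j ∈ {n : ℕ | 0 < n ∧ ∑ i ∈ s, a i n < (ε / 2) ^ 2} := by
    intro L
    obtain ⟨M, hM⟩ := hthick (L + 1)
    refine ⟨M + 1, fun j hj => ⟨by omega, ?_⟩⟩
    have := hM (j + 1) (by omega)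
    rwa [show M + (j + 1) = M + 1 + j by ring] at this
  obtain ⟨U, hTU, hU⟩ := exists_idempotent_ultrafilter_of_thick hthick'
  have hrec : ∀ᶠ n : ℕ in U, ∀ i, ∀ x ∈ F, 0 ≤ (fourier ((P i).eval (n : ℤ)) x : ℂ).re := by
    rw [eventually_all]
    intro i
    rw [eventually_all_finite hF]
    intro x _
    have h1 := tendsto_eval_zsmul_idempotent hU x (P i) (hP i)
    have h2 : Continuous fun y : UnitAddCircle => ((AddCircle.toCircle y : Circle) : ℂ).re := by
      have := AddCircle.continuous_toCircle (T := 1)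
      fun_prop
    have h3 := (h2.tendsto 0).comp h1
    simp only [AddCircle.toCircle_zero, Circle.coe_one, Complex.one_re] at h3
    filter_upwards [h3.eventually_const_le (show (0 : ℝ) < 1 by norm_num)] with n hn
    rw [fourier_apply]
    exact hn
  obtain ⟨n, hn, hnpos, hnsum⟩ := (hrec.and hTU).exists
  refine ⟨n, hnpos, fun i => ?_⟩
  set f : UnitAddCircle → ℂ := fun x => fourier ((P i).eval (n : ℤ)) x with hf
  have hint : ∀ ν : Measure UnitAddCircle, IsFiniteMeasure ν → Integrable f ν := fun ν _ =>
    Integrable.of_bound (C := 1) (by fun_prop) (ae_of_all _ fun _ => (Circle.norm_coe _).le)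
  by_cases hi : 0 < (P i).natDegree
  · have hsplit : ∫ x, f x ∂μ = ∫ x in F, f x ∂μ + ∫ x in C \ F, f x ∂μ + ∫ x in Cᶜ, f x ∂μ := by
      rw [← integral_add_compl hC (hint μ inferInstance), ← setIntegral_union
        Set.disjoint_sdiff_right (hC.diff hF.measurableSet) (hint _ inferInstance)
        (hint _ inferInstance), Set.union_sdiff_cancel hFC]
    have h1 : 0 ≤ (∫ x in F, f x ∂μ).re := by
      have := Complex.reCLM.integral_comp_comm (hint (μ.restrict F) inferInstance)
      simp only [Complex.reCLM_apply] at this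
      rw [← this]
      exact setIntegral_nonneg hF.measurableSet fun x hx => hn i x hx
    have h2 : ‖∫ x in C \ F, f x ∂μ‖ < ε / 2 := by
      refine lt_of_le_of_lt (norm_setIntegral_le_of_norm_le_const (C := 1)
        (measure_lt_top _ _) fun x _ => (Circle.norm_coe _).le) ?_
      rwa [one_mul]
    have h3 : ‖∫ x in Cᶜ, f x ∂μ‖ < ε / 2 := by
      refine lt_of_pow_lt_pow_left₀ 2 (half_pos hε).le (lt_of_le_of_lt ?_ hnsum)
      exact Finset.single_le_sum (f := fun i => a i n) (fun i _ => sq_nonneg _)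
        (Finset.mem_filter.2 ⟨Finset.mem_univ i, hi⟩)
    rw [hsplit, Complex.add_re, Complex.add_re]
    have h4 := (abs_le.1 (Complex.abs_re_le_norm (∫ x in C \ F, f x ∂μ))).1
    have h5 := (abs_le.1 (Complex.abs_re_le_norm (∫ x in Cᶜ, f x ∂μ))).1
    linarith
  · have h0 := Polynomial.eq_C_of_natDegree_eq_zero (Nat.eq_zero_of_not_pos hi)
    have hPi := hP i
    have h1 : (P i).eval (n : ℤ) = 0 := by
      rw [h0] at hPi ⊢
      simpa using hPi
    have h2 : f = fun _ => 1 := by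
      funext x
      simp only [hf, h1, fourier_zero]
    rw [h2]
    simp only [integral_const]
    have : (0 : ℝ) ≤ μ.real Set.univ := measureReal_nonneg
    simp
    linarith

/-! ### From sets of integers to measures -/

theorem integral_fourier_haarAddCircle (k : ℤ) :
    ∫ x : UnitAddCircle, (fourier k x : ℂ) ∂AddCircle.haarAddCircle = if k = 0 then 1 else 0 := by
  split_ifs with hk
  · subst hk
    simp
  · exact integral_eq_zero_of_add_right_eq_neg (fourier_add_half_inv_index hk one_pos)

/-- The autocorrelations of a finitely supported real function are the Fourier coefficients of a
finite positive measure. -/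
theorem exists_finiteMeasure_autocorrelation (I : Finset ℤ) (f : ℤ → ℝ) (N : ℕ) :
    ∃ μ : FiniteMeasure UnitAddCircle, ∀ m : ℤ, ∫ x, (fourier m x : ℂ) ∂(μ : Measure UnitAddCircle) =
      (((∑ a ∈ I, ∑ b ∈ I, if m + a = b then f a * f b else 0) / N : ℝ) : ℂ) := by
  -- The density is |S|²/N; orthogonality of characters keeps exactly the pairs with m + a = b.
  let S : UnitAddCircle → ℂ := fun x => ∑ a ∈ I, (f a : ℂ) * fourier a x
  let g : UnitAddCircle → ℝ := fun x => ‖S x‖ ^ 2 / N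
  have hS : Continuous S := by fun_prop
  have hg : Continuous g := by fun_prop
  let μ : Measure UnitAddCircle :=
    AddCircle.haarAddCircle.withDensity fun x => ENNReal.ofReal (g x)
  have hint : ∀ h : UnitAddCircle → ℂ, Continuous h → Integrable h AddCircle.haarAddCircle :=
    fun h hh => hh.integrable_of_hasCompactSupport (HasCompactSupport.of_compactSpace h)
  have hfin : IsFiniteMeasure μ := isFiniteMeasure_withDensity_ofReal
    (hg.integrable_of_hasCompactSupport (HasCompactSupport.of_compactSpace g)).2
  refine ⟨⟨μ, hfin⟩, fun m => ?_⟩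
  have h1 : ∫ x, (fourier m x : ℂ) ∂μ =
      ∫ x, (g x).toNNReal • (fourier m x : ℂ) ∂AddCircle.haarAddCircle :=
    integral_withDensity_eq_integral_smul (f := fun x => (g x).toNNReal)
      (by fun_prop) _
  have h2 : ∀ x, (g x).toNNReal • (fourier m x : ℂ) =
      (∑ a ∈ I, ∑ b ∈ I, ((f a * f b : ℝ) : ℂ) * fourier (m + a - b) x) / N := by
    intro x
    rw [NNReal.smul_def, Real.coe_toNNReal _ (by positivity), Complex.real_smul]
    simp only [g]
    push_cast
    rw [← Complex.mul_conj', div_mul_eq_mul_div]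
    congr 1
    simp only [S, map_sum]
    rw [Finset.sum_mul_sum, Finset.sum_mul]
    refine Finset.sum_congr rfl fun a _ => ?_
    rw [Finset.sum_mul]
    refine Finset.sum_congr rfl fun b _ => ?_
    rw [map_mul, Complex.conj_ofReal, ← fourier_neg, sub_eq_add_neg, fourier_add, fourier_add]
    ring
  change ∫ x, (fourier m x : ℂ) ∂μ = _
  rw [h1]
  simp only [h2]
  rw [integral_div, integral_finsetSum _ fun a _ => hint _ (by fun_prop)]
  push_cast
  congr 1
  refine Finset.sum_congr rfl fun a _ => ?_
  rw [integral_finsetSum _ fun b _ => hint _ (by fun_prop)]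
  refine Finset.sum_congr rfl fun b _ => ?_
  rw [integral_const_mul, integral_fourier_haarAddCircle]
  simp only [sub_eq_zero, mul_ite, mul_one, mul_zero]
  split_ifs <;> simp

/-- Few elements of a set of integers of `{1, …, N}` leave that interval under a small shift. -/
theorem card_le_card_filter_shift_mem_Icc_add {N : ℕ} {A : Finset ℤ} (hA : A ⊆ Finset.Icc 1 (N : ℤ))
    (k : ℤ) : A.card ≤ (A.filter fun a => k + a ∈ Finset.Icc 1 (N : ℤ)).card + k.natAbs := by
  rw [← Finset.card_filter_add_card_filter_not (s := A) fun a => k + a ∈ Finset.Icc 1 (N : ℤ)]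
  gcongr
  have hsub : (A.filter fun a => ¬ k + a ∈ Finset.Icc 1 (N : ℤ)) ⊆
      Finset.Icc 1 (-k) ∪ Finset.Icc (N - k + 1) (N : ℤ) := by
    intro a ha
    obtain ⟨ha, hk⟩ := Finset.mem_filter.1 ha
    have := Finset.mem_Icc.1 (hA ha)
    simp only [Finset.mem_union, Finset.mem_Icc] at hk ⊢
    omega
  refine (Finset.card_le_card hsub).trans ((Finset.card_union_le _ _).trans ?_)
  rw [Int.card_Icc, Int.card_Icc]
  omega

/-- The autocorrelation of the balanced function of a set `A ⊆ {1, …, N}` is bounded in terms of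
`|A ∩ (A + m)|`. -/
theorem autocorrelation_balanced_le {N : ℕ} {A : Finset ℤ} (hA : A ⊆ Finset.Icc 1 (N : ℤ))
    (m : ℤ) {δ : ℝ} (hδ0 : 0 ≤ δ) (hδ1 : δ ≤ 1) (hδ : A.card = δ * N) :
    (∑ a ∈ Finset.Icc 1 (N : ℤ), ∑ b ∈ Finset.Icc 1 (N : ℤ), if m + a = b then
      ((if a ∈ A then 1 else 0) - δ) * ((if b ∈ A then 1 else 0) - δ) else 0) ≤
      ((A ∩ A.image (fun a => a + m)).card : ℝ) - δ ^ 2 * N + 2 * |(m : ℝ)| := by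
  set I := Finset.Icc 1 (N : ℤ) with hI
  have hrow : ∀ a ∈ I, (∑ b ∈ I, if m + a = b then
      ((if a ∈ A then (1 : ℝ) else 0) - δ) * ((if b ∈ A then 1 else 0) - δ) else 0) =
      (if a ∈ A ∧ m + a ∈ A then 1 else 0) - δ * (if a ∈ A ∧ m + a ∈ I then 1 else 0) -
        δ * (if m + a ∈ A then 1 else 0) + δ ^ 2 * (if m + a ∈ I then 1 else 0) := by
    intro a _
    rw [Finset.sum_ite_eq]
    have : m + a ∈ A → m + a ∈ I := fun h => hA h
    by_cases h3 : m + a ∈ I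
    · by_cases h1 : a ∈ A <;> by_cases h2 : m + a ∈ A <;> simp only [h1, h2, h3] <;> norm_num <;> ring
    · have h2 : m + a ∉ A := fun h => h3 (this h)
      simp [h2, h3]
  rw [Finset.sum_congr rfl hrow, Finset.sum_add_distrib, Finset.sum_sub_distrib,
    Finset.sum_sub_distrib, ← Finset.mul_sum, ← Finset.mul_sum, ← Finset.mul_sum]
  simp only [Finset.sum_boole]
  have e1 : (I.filter fun a => a ∈ A ∧ m + a ∈ A).card = (A ∩ A.image fun a => a + m).card := by
    refine Finset.card_bij (fun a _ => m + a) (fun a ha => ?_) (fun a _ b _ h => by simpa using h)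
      fun b hb => ?_
    · obtain ⟨-, h1, h2⟩ := Finset.mem_filter.1 ha
      exact Finset.mem_inter.2 ⟨h2, Finset.mem_image.2 ⟨a, h1, add_comm _ _⟩⟩
    · obtain ⟨h1, h2⟩ := Finset.mem_inter.1 hb
      obtain ⟨a, ha, rfl⟩ := Finset.mem_image.1 h2
      exact ⟨a, Finset.mem_filter.2 ⟨hA ha, ha, by rwa [add_comm]⟩, add_comm _ _⟩
  have e2 : (I.filter fun a => a ∈ A ∧ m + a ∈ I) = A.filter fun a => m + a ∈ I := by
    ext a
    simp only [Finset.mem_filter]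
    exact ⟨fun h => h.2, fun h => ⟨hA h.1, h⟩⟩
  have e3 : (I.filter fun a => m + a ∈ A).card = (A.filter fun b => -m + b ∈ I).card := by
    refine Finset.card_bij (fun a _ => m + a) (fun a ha => ?_) (fun a _ b _ h => by simpa using h)
      fun b hb => ?_
    · obtain ⟨h1, h2⟩ := Finset.mem_filter.1 ha
      exact Finset.mem_filter.2 ⟨h2, by simpa using h1⟩
    · obtain ⟨h1, h2⟩ := Finset.mem_filter.1 hb
      exact ⟨-m + b, Finset.mem_filter.2 ⟨h2, by simpa using h1⟩, by ring⟩
  have hnat : ((m.natAbs : ℕ) : ℝ) = |(m : ℝ)| := by rw [Nat.cast_natAbs, Int.cast_abs]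
  -- The two cross terms have coefficient -δ and need lower bounds, each losing |m| at the boundary;
  -- the δ² term needs only the upper bound N. The total error 2δ|m| is at most 2|m|.
  have b2 : (A.card : ℝ) ≤ (A.filter fun a => m + a ∈ I).card + |(m : ℝ)| := by
    rw [← hnat]
    exact_mod_cast card_le_card_filter_shift_mem_Icc_add hA m
  have b3 : (A.card : ℝ) ≤ (A.filter fun a => -m + a ∈ I).card + |(m : ℝ)| := by
    rw [← hnat, ← Int.natAbs_neg]
    exact_mod_cast card_le_card_filter_shift_mem_Icc_add hA (-m)
  have b4 : ((I.filter fun a => m + a ∈ I).card : ℝ) ≤ N := by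
    have h1 := Finset.card_filter_le I fun a => m + a ∈ I
    have h2 : I.card = N := by rw [hI, Int.card_Icc]; omega
    rw [h2] at h1
    exact_mod_cast h1
  rw [e1, e2, e3]
  have c2 := mul_le_mul_of_nonneg_left b2 hδ0
  have c3 := mul_le_mul_of_nonneg_left b3 hδ0
  have c4 := mul_le_mul_of_nonneg_left b4 (sq_nonneg δ)
  have c5 := mul_le_mul_of_nonneg_right hδ1 (abs_nonneg (m : ℝ))
  rw [hδ] at c2 c3
  nlinarith

/-- The balanced correlations of a set `A ⊆ {1, …, N}` dominate, up to boundary terms, the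
Fourier coefficients of a positive measure of mass at most one. -/
theorem exists_finiteMeasure_re_integral_fourier_le {N : ℕ} (hN : 0 < N) {A : Finset ℤ}
    (hA : A ⊆ Finset.Icc 1 (N : ℤ)) : ∃ μ : FiniteMeasure UnitAddCircle, μ.mass ≤ 1 ∧ ∀ m : ℤ,
      (∫ x, (fourier m x : ℂ) ∂(μ : Measure UnitAddCircle)).re ≤
        ((A ∩ A.image (fun a => a + m)).card : ℝ) / N - ((A.card : ℝ) / N) ^ 2 +
          2 * |(m : ℝ)| / N := by
  have hN' : (0 : ℝ) < N := by exact_mod_cast hN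
  set δ : ℝ := A.card / N with hδ
  have hcard : (A.card : ℝ) ≤ N := by
    have := Finset.card_le_card hA
    rw [Int.card_Icc] at this
    exact_mod_cast this.trans (by omega)
  have hδ0 : 0 ≤ δ := by positivity
  have hδ1 : δ ≤ 1 := div_le_one_of_le₀ hcard hN'.le
  have hδN : A.card = δ * N := by rw [hδ]; field_simp
  obtain ⟨μ, hμ⟩ := exists_finiteMeasure_autocorrelation (Finset.Icc 1 (N : ℤ))
    (fun a => (if a ∈ A then 1 else 0) - δ) N
  have hle : ∀ m : ℤ, (∫ x, (fourier m x : ℂ) ∂(μ : Measure UnitAddCircle)).re ≤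
      ((A ∩ A.image (fun a => a + m)).card : ℝ) / N - δ ^ 2 + 2 * |(m : ℝ)| / N := by
    intro m
    rw [hμ, Complex.ofReal_re, div_le_iff₀ hN']
    refine (autocorrelation_balanced_le hA m hδ0 hδ1 hδN).trans (le_of_eq ?_)
    field_simp
  refine ⟨μ, ?_, hle⟩
  -- The mass is the coefficient at 0, hence at most δ - δ² ≤ 1.
  have h0 := hle 0
  have hmass : (∫ x, (fourier 0 x : ℂ) ∂(μ : Measure UnitAddCircle)).re = μ.mass := by
    have h1 : ∀ x : UnitAddCircle, (fourier 0 x : ℂ) = 1 := fun x => fourier_zero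
    simp only [h1, integral_const, Complex.real_smul, mul_one, Complex.ofReal_re]
    rfl
  have hself : A.image (fun a => a + 0) = A := by simp
  rw [hmass, hself, Finset.inter_self, ← hδ] at h0
  have : (μ.mass : ℝ) ≤ 1 := by
    refine h0.trans ?_
    simp
    nlinarith
  exact_mod_cast this

/-! ### Compactness argument -/

theorem corollary1p2 (ℓ : ℕ) (P : Fin ℓ → Polynomial ℤ) (hP : ∀ i, (P i).eval 0 = 0)
    (ε : ℝ) (hε : 0 < ε) :
    ∃ N₀ : ℕ, ∀ N : ℕ, N₀ ≤ N → ∀ A : Finset ℤ, A ⊆ Finset.Icc 1 (N : ℤ) →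
      ∃ n : ℕ, 0 < n ∧ ∀ i : Fin ℓ,
        ((A ∩ A.image (fun a => a + (P i).eval (n : ℤ))).card : ℝ) / (N : ℝ) >
          ((A.card : ℝ) / (N : ℝ)) ^ 2 - ε := by
  by_contra! hcon
  -- Using the threshold k + 1 makes every `N k` positive and forces `N k` → ∞.
  choose N hN A hA hbad using fun k : ℕ => hcon (k + 1)
  choose μ hmass hμ using fun k : ℕ =>
    exists_finiteMeasure_re_integral_fourier_le (Nat.lt_of_lt_of_le k.succ_pos (hN k)) (hA k)
  obtain ⟨ν, -, hν⟩ := (isCompact_setOfPred_finiteMeasure_le_of_compactSpace UnitAddCircle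
    1).ultrafilter_le_nhds ((hyperfilter ℕ).map μ)
    (le_principal_iff.2 (Eventually.of_forall (f := (hyperfilter ℕ : Filter ℕ)) hmass))
  replace hν : Tendsto μ (hyperfilter ℕ) (𝓝 ν) := hν
  obtain ⟨n, hn, hrec⟩ := exists_re_integral_fourier_gt (ν : Measure UnitAddCircle) P hP
    (half_pos hε)
  have hNtop : Tendsto (fun k => (N k : ℝ)) (hyperfilter ℕ) atTop :=
    (tendsto_natCast_atTop_atTop.comp (tendsto_atTop_mono (fun k => (Nat.le_succ k).trans (hN k))
      tendsto_id)).mono_left Nat.hyperfilter_le_atTop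
  have hev : ∀ᶠ k in (hyperfilter ℕ : Filter ℕ), ∀ i,
      -(ε / 2) < (∫ x, (fourier ((P i).eval (n : ℤ)) x : ℂ) ∂(μ k : Measure UnitAddCircle)).re ∧
        2 * |(((P i).eval (n : ℤ) : ℤ) : ℝ)| / N k < ε / 2 := by
    rw [eventually_all]
    intro i
    -- Now n is fixed, so weak convergence transfers the coefficient bound and the boundary term
    -- vanishes as `N k` → ∞.
    have h1 := (FiniteMeasure.tendsto_iff_forall_integral_rclike_tendsto ℂ).1 hν
      (BoundedContinuousFunction.mkOfCompact (fourier ((P i).eval (n : ℤ))))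
    have h2 := (Complex.continuous_re.tendsto _).comp h1
    exact (h2.eventually_const_lt (hrec i)).and
      ((hNtop.const_div_atTop _).eventually_lt_const (half_pos hε))
  obtain ⟨k, hk⟩ := hev.exists
  obtain ⟨i, hi⟩ := hbad k n hn
  have h1 := hμ k ((P i).eval (n : ℤ))
  obtain ⟨h2, h3⟩ := hk i
  linarith
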